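/- Infinite words are indexed by $\mathbb N$, and factors are finite blocks of consecutive letters. A finite word $v$ is a repetition of exponent $e=|v|/|u|$ if it is a prefix of $uuu\cdots$ for some nonempty word $u$. An infinite word is $\beta^+$-free if none of its factors is a repetition of exponent $e>\beta$. A palindrome is a finite word equal to its reversal (the empty word counts). We say that there are exponentially many infinite words in a set $S$ of infinite binary words if there are constants $C>0$ and $c>1$ such that, for every $n\ge 0$, the words of $S$ have at least $C\,c^n$ distinct prefixes of length $n$. Theorem. There are exponentially many infinite binary $\beta^+$-free words containing at most $p$ distinct palindromes (as factors), for each of the following pairs $(p,\beta)$: $(11,\tfrac{10}{3})$, $(12,\tfrac{23}{7})$, $(13,3)$, $(15,\tfrac{8}{3})$, $(18,\tfrac{13}{5})$, $(19,\tfrac{28}{11})$, $(21,\tfrac{5}{2})$, $(25,\tfrac{7}{3})$. -/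

import Mathlib

namespace InfWord

/-- The block `x i, x (i+1), …, x (i+n-1)` of the infinite word `x`. -/
def block {A : Type*} (x : ℕ → A) (i n : ℕ) : List A :=
  (List.range n).map fun j => x (i + j)

/-- The finite word `w` (possibly empty) is a factor of the infinite word `x`. -/
def IsFactor {A : Type*} (w : List A) (x : ℕ → A) : Prop :=
  ∃ i : ℕ, w = block x i w.length

/-- `v = u ^ e`: the word `u` is nonempty, `v` is a prefix of the periodic infinite word `uuu⋯`
(equivalently, of some finite repetition `uu⋯u`), and `e = |v| / |u|`. -/
def IsPower {A : Type*} (v u : List A) (e : ℚ) : Prop :=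
  u ≠ [] ∧ (∃ k : ℕ, v <+: (List.replicate k u).flatten) ∧
    e = (v.length : ℚ) / (u.length : ℚ)

/-- The infinite word `x` is `β⁺`-free: it contains no repetition of exponent `e > β`. -/
def PlusFree {A : Type*} (β : ℚ) (x : ℕ → A) : Prop :=
  ¬ ∃ (v u : List A) (e : ℚ), IsFactor v x ∧ IsPower v u e ∧ β < e

/-- The set of palindromes (the empty word included) that occur in the infinite word `x`. -/
def palindromes {A : Type*} (x : ℕ → A) : Set (List A) :=
  {w | IsFactor w x ∧ w.reverse = w}

/-- The infinite binary `β⁺`-free words containing at most `p` distinct palindromes. -/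
def fewPalindromes (p : ℕ) (β : ℚ) : Set (ℕ → Fin 2) :=
  {x | PlusFree β x ∧ (palindromes x).encard ≤ p}

/-- The prefixes of length `n` of the infinite words in `S`. -/
def prefixes (S : Set (ℕ → Fin 2)) (n : ℕ) : Set (List (Fin 2)) :=
  {w | ∃ x ∈ S, w = block x 0 n}

/-- A set `S` of infinite binary words has exponentially many elements: the number of prefixes of
length `n` of its elements grows at least exponentially in `n` (it is at most `2 ^ n`). -/
def ExponentiallyMany (S : Set (ℕ → Fin 2)) : Prop :=
  ∃ C c : ℝ, 0 < C ∧ 1 < c ∧ ∀ n : ℕ, C * c ^ n ≤ ((prefixes S n).ncard : ℝ)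

end InfWord

/-! ### Exponential growth of squarefree words over four letters -/

namespace InfWord

/-! For each pair (p, β) there is an explicit q-uniform morphism from four letters to two that sends
every infinite squarefree word to a β⁺-free word with at most p palindromes. Infinite squarefree
words over four letters have at least 2^n prefixes of length n
(`two_pow_le_ncard_prefixes_squarefree`), and letters are recovered from their images, so the images
have at least 2^⌊n/q⌋ prefixes of length n.

The growth bound is a counting argument: a left extension of a squarefree word that fails to be
squarefree is a square followed by a rest, hence is determined by a shorter squarefree word.
Counting only words with arbitrarily long right extensions then gives prefixes of infinite words.

That a morphism works reduces to a finite check. Short periods are excluded by inspecting images of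
three-letter words (`not_run_of_lt_period`). For a longer period, a repetition of exponent above β
contains a marker that occurs only at the start of an image, so the period is a multiple of q
(`dvd_period`); since β ≥ 2, the repetition then pulls back to a square in the source word
(`not_run_of_dvd_period`). Palindromes are listed from images of two-letter words, and two
consecutive lengths without palindromes exclude all greater lengths. -/

theorem length_block {A : Type*} (x : ℕ → A) (i n : ℕ) : (block x i n).length = n := by
  simp [block]

theorem getElem_block {A : Type*} (x : ℕ → A) (i n j : ℕ) (h : j < (block x i n).length) :
    (block x i n)[j] = x (i + j) := by
  simp [block]

theorem block_add {A : Type*} (x : ℕ → A) (i m n : ℕ) :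
    block x i (m + n) = block x i m ++ block x (i + m) n := by
  apply List.ext_getElem
  · simp [length_block]
  · intro j h₁ h₂
    rw [getElem_block]
    by_cases hj : j < m
    · rw [List.getElem_append_left (by simpa [length_block] using hj), getElem_block]
    · rw [List.getElem_append_right (by simpa [length_block] using hj), getElem_block]
      simp only [length_block]
      congr 1
      omega

theorem block_eq_block_iff {A : Type*} (x y : ℕ → A) (i k n : ℕ) :
    block x i n = block y k n ↔ ∀ j < n, x (i + j) = y (k + j) := by
  simp [block]

/-- A finite word is squarefree if it has no factor `uu` with `u` nonempty. -/
def SquarefreeWord {A : Type*} (w : List A) : Prop :=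
  ∀ u : List A, u ≠ [] → ¬ (u ++ u) <:+: w

theorem SquarefreeWord.of_infix {A : Type*} {v w : List A} (hw : SquarefreeWord w)
    (h : v <:+: w) : SquarefreeWord v :=
  fun u hu hv => hw u hu (hv.trans h)

theorem squarefreeWord_nil {A : Type*} : SquarefreeWord ([] : List A) := by
  intro u hu h
  have := List.eq_nil_of_infix_nil h
  simp_all

/-- The squarefree words of length `n` over an alphabet of four letters. -/
def sqfreeWords (n : ℕ) : Set (List (Fin 4)) :=
  {w | w.length = n ∧ SquarefreeWord w}

theorem finite_sqfreeWords (n : ℕ) : (sqfreeWords n).Finite :=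
  (List.finite_length_eq (Fin 4) n).subset fun _ h => h.1

theorem ncard_sqfreeWords_zero : (sqfreeWords 0).ncard = 1 := by
  have : sqfreeWords 0 = {[]} := by
    ext w
    simp only [sqfreeWords, List.length_eq_zero_iff, Set.mem_ofPred_eq, Set.mem_singleton_iff]
    exact ⟨fun h => h.1, fun h => ⟨h, h ▸ squarefreeWord_nil⟩⟩
  rw [this, Set.ncard_singleton]

/-- Extending a squarefree word by a letter on the left creates a square only as a prefix. -/
theorem exists_prefix_of_not_squarefree {A : Type*} {a : A} {w : List A}
    (hw : SquarefreeWord w) (h : ¬ SquarefreeWord (a :: w)) :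
    ∃ u t : List A, u ≠ [] ∧ a :: w = u ++ (u ++ t) := by
  simp only [SquarefreeWord, not_forall, not_not] at h
  obtain ⟨u, hu, h⟩ := h
  rcases List.infix_cons_iff.1 h with ⟨t, ht⟩ | h
  · exact ⟨u, t, hu, by rw [← ht, List.append_assoc]⟩
  · exact absurd h (hw u hu)

/-- A left extension that is not squarefree has the form uut with ut squarefree of some length k ≤
n. As |u| = n + 1 - k, the word ut determines u, so at most one bad extension arises from each
squarefree word of length k. -/
theorem four_mul_ncard_sqfreeWords_le (n : ℕ) :
    4 * (sqfreeWords n).ncard ≤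
      (sqfreeWords (n + 1)).ncard + ∑ k ∈ Finset.range (n + 1), (sqfreeWords k).ncard := by
  classical
  set ext : Set (List (Fin 4)) :=
    (fun z : Fin 4 × List (Fin 4) => z.1 :: z.2) '' (Set.univ ×ˢ sqfreeWords n)
  have hext : ext.ncard = 4 * (sqfreeWords n).ncard := by
    rw [Set.ncard_image_of_injective _ (fun z z' h => by
      simp only [List.cons.injEq] at h; exact Prod.ext h.1 h.2), Set.ncard_prod]
    simp
  let double : ℕ → Set (List (Fin 4)) := fun k =>
    (fun v : List (Fin 4) => v.take (n + 1 - k) ++ v) '' sqfreeWords k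
  have hcover : ext ⊆ sqfreeWords (n + 1) ∪ ⋃ k ∈ Finset.range (n + 1), double k := by
    rintro _ ⟨⟨a, w⟩, ⟨-, hw⟩, rfl⟩
    by_cases h : SquarefreeWord (a :: w)
    · exact Or.inl ⟨by simp [hw.1], h⟩
    · obtain ⟨u, t, hu, hut⟩ := exists_prefix_of_not_squarefree hw.2 h
      right
      have hlen := congrArg List.length hut
      have hupos := List.length_pos_iff.2 hu
      simp only [List.length_cons, List.length_append, hw.1] at hlen
      simp only [Finset.mem_range, Set.mem_iUnion]
      refine ⟨u.length + t.length, by omega, u ++ t, ⟨by simp, hw.2.of_infix ?_⟩, ?_⟩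
      · obtain ⟨b, u', rfl⟩ := List.exists_cons_of_ne_nil hu
        simp only [List.cons_append, List.cons.injEq] at hut
        rw [hut.2]
        exact (List.suffix_append _ _).isInfix
      · have h1 : n + 1 - (u.length + t.length) = u.length := by omega
        simp only [h1, List.take_left']
        exact hut.symm
  have hfin : ∀ k, (double k).Finite := fun k => (finite_sqfreeWords k).image _
  calc 4 * (sqfreeWords n).ncard = ext.ncard := hext.symm
    _ ≤ (sqfreeWords (n + 1) ∪ ⋃ k ∈ Finset.range (n + 1), double k).ncard :=
        Set.ncard_le_ncard hcover ((finite_sqfreeWords _).union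
          (Set.Finite.biUnion (Finset.finite_toSet _) fun k _ => hfin k))
    _ ≤ (sqfreeWords (n + 1)).ncard + (⋃ k ∈ Finset.range (n + 1), double k).ncard :=
        Set.ncard_union_le _ _
    _ ≤ (sqfreeWords (n + 1)).ncard + ∑ k ∈ Finset.range (n + 1), (double k).ncard :=
        Nat.add_le_add_left (Finset.set_ncard_biUnion_le _ _) _
    _ ≤ _ := Nat.add_le_add_left
        (Finset.sum_le_sum fun k _ => Set.ncard_image_le (finite_sqfreeWords k)) _

/-- Writing s for the counts, the bound at n gives s(n+1) ≥ 4s(n) - 2s(n) = 2s(n), and this carries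
the sum bound to n + 1. Doubling and the sum bound thus sustain each other. -/
theorem sum_ncard_sqfreeWords_le (n : ℕ) :
    ∑ k ∈ Finset.range (n + 1), (sqfreeWords k).ncard ≤ 2 * (sqfreeWords n).ncard := by
  induction n with
  | zero => simp [ncard_sqfreeWords_zero]
  | succ n ih =>
    have := four_mul_ncard_sqfreeWords_le n
    rw [Finset.sum_range_succ]
    omega

theorem two_pow_mul_ncard_sqfreeWords_le (n m : ℕ) :
    2 ^ n * (sqfreeWords m).ncard ≤ (sqfreeWords (n + m)).ncard := by
  induction n with
  | zero => simp
  | succ n ih =>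
    have h₁ := four_mul_ncard_sqfreeWords_le (n + m)
    have h₂ := sum_ncard_sqfreeWords_le (n + m)
    rw [show n + 1 + m = n + m + 1 by omega, pow_succ]
    linarith

theorem ncard_sqfreeWords_pos (n : ℕ) : 0 < (sqfreeWords n).ncard := by
  have h := two_pow_mul_ncard_sqfreeWords_le n 0
  rw [ncard_sqfreeWords_zero] at h
  exact lt_of_lt_of_le (by positivity) h

/-- The words that have squarefree extensions to the right of every length. -/
def Extendable (w : List (Fin 4)) : Prop :=
  ∀ m : ℕ, ∃ t : List (Fin 4), t.length = m ∧ SquarefreeWord (w ++ t)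

theorem Extendable.squarefree {w : List (Fin 4)} (h : Extendable w) : SquarefreeWord w := by
  obtain ⟨t, -, ht⟩ := h 0
  exact ht.of_infix (List.prefix_append _ _).isInfix

theorem not_squarefree_of_le {w : List (Fin 4)} {m n : ℕ} (hmn : m ≤ n)
    (h : ∀ t : List (Fin 4), t.length = m → ¬ SquarefreeWord (w ++ t)) (t : List (Fin 4))
    (ht : t.length = n) : ¬ SquarefreeWord (w ++ t) := by
  intro hs
  refine h (t.take m) (by simp [ht, hmn]) (hs.of_infix ?_)
  exact ((List.prefix_append_right_inj w).2 (List.take_prefix m t)).isInfix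

/-- König's lemma: if each one-letter extension failed at some length, the maximum of these finitely
many lengths would stop `w` itself. -/
theorem Extendable.exists_append {w : List (Fin 4)} (h : Extendable w) :
    ∃ a : Fin 4, Extendable (w ++ [a]) := by
  by_contra! hc
  simp only [Extendable, not_forall, not_exists, not_and] at hc
  choose m hm using hc
  obtain ⟨t, ht, hs⟩ := h (Finset.univ.sup m + 1)
  obtain ⟨a, t', rfl⟩ := List.exists_cons_of_length_eq_add_one ht
  refine not_squarefree_of_le (Finset.le_sup (f := m) (Finset.mem_univ a)) (hm a) t'
    (by simpa using ht) ?_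
  simpa using hs

/-- Choose M so large that no squarefree word of length n that is not extendable has a squarefree
continuation by M letters. Cutting at n sends squarefree words of length n + M injectively to pairs
of an extendable word and a squarefree word of length M. There are at least 2^n · s(M) of the
former, where s(M) counts squarefree words of length M, and s(M) cancels. -/
theorem two_pow_le_ncard_extendable (n : ℕ) :
    2 ^ n ≤ {w : List (Fin 4) | w.length = n ∧ Extendable w}.ncard := by
  classical
  set E := {w : List (Fin 4) | w.length = n ∧ Extendable w}
  have hEfin : E.Finite := (List.finite_length_eq (Fin 4) n).subset fun _ h => h.1
  have hbound : ∀ w : List (Fin 4), ∃ m : ℕ, ¬ Extendable w →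
      ∀ t : List (Fin 4), t.length = m → ¬ SquarefreeWord (w ++ t) := by
    intro w
    by_cases hw : Extendable w
    · exact ⟨0, fun h => absurd hw h⟩
    · simp only [Extendable, not_forall, not_exists, not_and] at hw
      obtain ⟨m, hm⟩ := hw
      exact ⟨m, fun _ => hm⟩
  choose m hm using hbound
  set M := (finite_sqfreeWords n).toFinset.sup m
  have hmaps : ∀ v ∈ sqfreeWords (n + M),
      (fun v : List (Fin 4) => (v.take n, v.drop n)) v ∈ E ×ˢ sqfreeWords M := by
    rintro v ⟨hv, hsq⟩
    have htake : (v.take n).length = n := by simp [hv]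
    have hdrop : (v.drop n).length = M := by simp [hv]
    refine ⟨⟨htake, ?_⟩, hdrop, hsq.of_infix (List.drop_suffix n v).isInfix⟩
    by_contra hne
    refine not_squarefree_of_le (n := M) (Finset.le_sup (f := m) ?_) (hm (v.take n) hne)
      (v.drop n) hdrop (by simpa using hsq)
    simp only [Set.Finite.mem_toFinset]
    exact ⟨htake, hsq.of_infix (List.take_prefix n v).isInfix⟩
  have hinj : Set.InjOn (fun v : List (Fin 4) => (v.take n, v.drop n)) (sqfreeWords (n + M)) := by
    intro v _ v' _ h
    simp only [Prod.mk.injEq] at h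
    rw [← List.take_append_drop n v, ← List.take_append_drop n v', h.1, h.2]
  have h₁ := Set.ncard_le_ncard_of_injOn _ hmaps hinj (hEfin.prod (finite_sqfreeWords M))
  rw [Set.ncard_prod] at h₁
  exact Nat.le_of_mul_le_mul_right ((two_pow_mul_ncard_sqfreeWords_le n M).trans h₁)
    (ncard_sqfreeWords_pos M)

/-- An infinite word is squarefree if it has no factor `uu` with `u` nonempty. -/
def SquarefreeInf {A : Type*} (x : ℕ → A) : Prop :=
  ∀ i r : ℕ, 0 < r → ¬ ∀ j < r, x (i + j) = x (i + r + j)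

theorem squarefreeInf_of_block {A : Type*} {x : ℕ → A}
    (h : ∀ n, SquarefreeWord (block x 0 n)) : SquarefreeInf x := by
  intro i r hr heq
  refine h (i + (r + r)) (block x i r) ?_ ?_
  · rw [← List.length_pos_iff, length_block]
    exact hr
  · rw [block_add x 0, Nat.zero_add, block_add x i,
      ← (block_eq_block_iff x x i (i + r) r).2 heq]
    exact (List.suffix_append _ _).isInfix

theorem Extendable.exists_infinite {w : List (Fin 4)} (h : Extendable w) :
    ∃ x : ℕ → Fin 4, SquarefreeInf x ∧ block x 0 w.length = w := by
  choose next hnext using fun v : {v // Extendable v} => v.2.exists_append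
  let L : ℕ → {v : List (Fin 4) // Extendable v} := fun k =>
    Nat.rec ⟨w, h⟩ (fun _ v => ⟨v.1 ++ [next v], hnext v⟩) k
  have hsucc : ∀ k, (L (k + 1)).1 = (L k).1 ++ [next (L k)] := fun k => rfl
  have hlen : ∀ k, (L k).1.length = w.length + k := by
    intro k
    induction k with
    | zero => rfl
    | succ k ih => rw [hsucc, List.length_append, ih]; rfl
  have hmono : ∀ k d, (L k).1 <+: (L (k + d)).1 := by
    intro k d
    induction d with
    | zero => exact List.prefix_rfl
    | succ d ih => exact ih.trans (hsucc (k + d) ▸ List.prefix_append _ _)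
  let x : ℕ → Fin 4 := fun i => (L (i + 1)).1[i]'(by have := hlen (i + 1); omega)
  have hx : ∀ k i (hi : i < (L k).1.length), x i = (L k).1[i] := by
    intro k i hi
    rcases le_total k (i + 1) with hk | hk
    · obtain ⟨d, hd⟩ := Nat.exists_eq_add_of_le hk
      have := (hmono k d).getElem hi
      simp only [x]
      simp only [hd, this]
    · obtain ⟨d, hd⟩ := Nat.exists_eq_add_of_le hk
      have := (hmono (i + 1) d).getElem (i := i) (by have := hlen (i + 1); omega)
      simp only [x, this]
      simp only [hd]
  have hblock : ∀ k, block x 0 (w.length + k) = (L k).1 := by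
    intro k
    apply List.ext_getElem
    · rw [length_block, hlen]
    · intro j h₁ h₂
      rw [getElem_block, Nat.zero_add, hx k j h₂]
  refine ⟨x, squarefreeInf_of_block fun n => ?_, hblock 0⟩
  refine (L n).2.squarefree.of_infix ?_
  rw [← hblock n, Nat.add_comm, block_add]
  exact (List.prefix_append _ _).isInfix

/-- There are at least `2 ^ n` prefixes of length `n` of infinite squarefree words over four
letters. -/
theorem two_pow_le_ncard_prefixes_squarefree (n : ℕ) :
    2 ^ n ≤ {w : List (Fin 4) | ∃ x, SquarefreeInf x ∧ block x 0 n = w}.ncard := by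
  refine (two_pow_le_ncard_extendable n).trans (Set.ncard_le_ncard ?_ ?_)
  · rintro w ⟨rfl, hw⟩
    exact hw.exists_infinite
  · refine (List.finite_length_eq (Fin 4) n).subset ?_
    rintro w ⟨x, -, rfl⟩
    exact length_block x 0 n

end InfWord

/-! ### Bit-parallel tests on words coded as natural numbers -/

namespace InfWord

/-- Evaluates `n` before passing it on, for efficient reduction in the kernel. -/
def force {α : Type*} (n : ℕ) (f : ℕ → α) : α :=
  match n with
  | 0 => f 0
  | k + 1 => f (k + 1)

theorem force_eq {α : Type*} (n : ℕ) (f : ℕ → α) : force n f = f n := by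
  cases n <;> rfl

/-- With `k = 1`, the bits `i` such that one of the bits `i, …, i + l - 1` of `D` is set (given
enough fuel): `D` accumulates windows of length `k`. -/
def spread : ℕ → ℕ → ℕ → ℕ → ℕ
  | 0, _, _, D => D
  | fuel + 1, k, l, D =>
    if 2 * k ≤ l then force (D ||| D >>> k) fun D' => spread fuel (2 * k) l D'
    else D ||| D >>> (l - k)

/-- As `D` already accumulates windows of length `k`, offsets up to `l - k` make up a window of
length `l`. Only this direction is needed: too little fuel loses bits and could merely make a check
fail. -/
theorem exists_of_testBit_spread (fuel k l D i : ℕ) (hk : 0 < k) (hkl : k ≤ l)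
    (h : (spread fuel k l D).testBit i = true) : ∃ j ≤ l - k, D.testBit (i + j) = true := by
  induction fuel generalizing k D with
  | zero => exact ⟨0, Nat.zero_le _, h⟩
  | succ fuel ih =>
    rw [spread, force_eq] at h
    split_ifs at h with hl
    · obtain ⟨j, hj, h⟩ := ih (2 * k) (D ||| D >>> k) (by omega) hl h
      simp only [Nat.testBit_or, Nat.testBit_shiftRight, Bool.or_eq_true] at h
      rcases h with h | h
      · exact ⟨j, by omega, h⟩
      · exact ⟨k + j, by omega, by rwa [show i + (k + j) = k + (i + j) by omega]⟩
    · simp only [Nat.testBit_or, Nat.testBit_shiftRight, Bool.or_eq_true] at h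
      rcases h with h | h
      · exact ⟨0, by omega, h⟩
      · exact ⟨l - k, le_rfl, by rwa [Nat.add_comm]⟩

/-- The bits `i` such that the word of length `n` with code `c` occurs in `N` at position `i`. -/
def matchMask (ones N c : ℕ) : ℕ → ℕ
  | 0 => ones
  | n + 1 => matchMask ones N c n &&& (if c.testBit n then N >>> n else N >>> n ^^^ ones)

theorem testBit_matchMask (q N c n i : ℕ) (hi : i < q) :
    (matchMask (2 ^ q - 1) N c n).testBit i = true ↔
      ∀ j < n, N.testBit (i + j) = c.testBit j := by
  induction n with
  | zero => simp [matchMask, hi]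
  | succ n ih =>
    rw [matchMask, Nat.testBit_and, Bool.and_eq_true, ih, Nat.forall_lt_succ_right]
    refine and_congr_right fun _ => ?_
    cases c.testBit n <;> simp [hi, Nat.add_comm]

/-- The bits `i` such that the factor of length `n` of `N` at position `i` is not a palindrome. -/
def nonPalMask (N : ℕ) : ℕ → ℕ
  | 0 => 0
  | 1 => 0
  | n + 2 => nonPalMask N n >>> 1 ||| (N ^^^ N >>> (n + 1))

theorem not_palindrome_of_testBit_nonPalMask (N : ℕ) : ∀ n i : ℕ,
    (nonPalMask N n).testBit i = true →
      ∃ j k : ℕ, j + k + 1 = n ∧ N.testBit (i + j) ≠ N.testBit (i + k)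
  | 0, i, h => by simp [nonPalMask] at h
  | 1, i, h => by simp [nonPalMask] at h
  | n + 2, i, h => by
    simp only [nonPalMask, Nat.testBit_or, Nat.testBit_shiftRight, Nat.testBit_xor,
      Bool.or_eq_true] at h
    rcases h with h | h
    · obtain ⟨j, k, hjk, hne⟩ := not_palindrome_of_testBit_nonPalMask N n _ h
      refine ⟨j + 1, k + 1, by omega, ?_⟩
      rwa [show i + (j + 1) = 1 + i + j by omega, show i + (k + 1) = 1 + i + k by omega]
    · refine ⟨0, n + 1, by omega, ?_⟩
      rw [Nat.add_comm i (n + 1)]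
      simpa using h

/-- The concatenation of blocks of `K` binary digits, the first block being the least
significant one. -/
def concat (K : ℕ) : List ℕ → ℕ
  | [] => 0
  | n :: l => 2 ^ K * concat K l + n

/-- Each block occurs in the concatenation, aligned with `m` in the concatenation of as many
copies of `m`. -/
theorem exists_testBit_concat (K m : ℕ) (hm : m < 2 ^ K) (l : List ℕ) (hl : ∀ n ∈ l, n < 2 ^ K)
    (n : ℕ) (hn : n ∈ l) : ∃ t, ∀ i < K, (concat K l).testBit (t + i) = n.testBit i ∧
      (concat K (l.map fun _ => m)).testBit (t + i) = m.testBit i := by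
  induction l with
  | nil => simp at hn
  | cons n' l ih =>
    have hn' := hl n' List.mem_cons_self
    rcases List.mem_cons.1 hn with rfl | hn
    · refine ⟨0, fun i hi => ?_⟩
      simp [concat, Nat.testBit_two_pow_mul_add _ hn', Nat.testBit_two_pow_mul_add _ hm, hi]
    · obtain ⟨t, ht⟩ := ih (fun n hn => hl n (List.mem_cons_of_mem _ hn)) hn
      refine ⟨K + t, fun i hi => ?_⟩
      have h1 : ¬ K + t + i < K := by omega
      have h2 : K + t + i - K = t + i := by omega
      simp only [concat, List.map_cons, Nat.testBit_two_pow_mul_add _ hn',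
        Nat.testBit_two_pow_mul_add _ hm, h1, h2, if_false, ht i hi, and_self]

/-! ### The finite certificate for a uniform morphism -/

/-- A `q`-uniform morphism on four letters together with the data that show that it maps
squarefree words to words with few palindromes and bounded exponents. Words are encoded by
the binary digits of natural numbers, the least significant digit first. -/
structure Morphism where
  /-- the length of the images -/
  q : ℕ
  /-- the numerator of the bound for the exponents -/
  num : ℕ
  /-- the denominator of the bound for the exponents -/
  den : ℕ
  /-- the common prefix of this length occurs only at the beginning of an image -/
  marker : ℕ
  /-- larger periods than this are multiples of `q` -/
  period : ℕ
  /-- the prefixes of this length of the images are distinct -/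
  pre : ℕ
  /-- the suffixes of the images from this position on are distinct -/
  suf : ℕ
  /-- the maximal length of a palindrome -/
  maxPal : ℕ
  /-- the images of the letters -/
  code : Fin 4 → ℕ
  /-- the lengths and codes of the palindromes -/
  pals : List (ℕ × ℕ)

namespace Morphism

/-- The letters of the source alphabet. -/
def letters : List (Fin 4) := [0, 1, 2, 3]

theorem mem_letters (a : Fin 4) : a ∈ letters := by
  revert a; decide

variable (h : Morphism)

/-- The code of the image of a word of length two. -/
def pair (a b : Fin 4) : ℕ := 2 ^ h.q * h.code b + h.code a

/-- The code of the image of a word of length three. -/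
def triple (a b c : Fin 4) : ℕ := 2 ^ h.q * h.pair b c + h.code a

/-- The length of the overlap of a shortest forbidden repetition of period `p`. -/
def overlap (p : ℕ) : ℕ := h.num * p / h.den + 1 - p

/-- The codes of the images of the words `abc` with `a ≠ b` and `b ≠ c`. -/
def triples : List ℕ :=
  letters.flatMap fun a => (letters.filter fun b => a != b).flatMap fun b =>
    (letters.filter fun c => b != c).map fun c => h.triple a b c

/-- No forbidden repetition with a period below `h.period` starts at a position of `N` that
belongs to `mask`. -/
def checkRuns (N mask : ℕ) : Bool :=
  (List.range h.period).all fun p => p == 0 ||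
    (decide (h.overlap p + p ≤ 2 * h.q + 1) &&
      spread 12 1 (h.overlap p) (N ^^^ N >>> p) &&& mask == mask)

/-- All triples are joined into one number, so each period is tested on all of them by a few
operations on large numbers. The mask `2 ^ q - 1` in each block restricts starting positions to the
first of the three images. -/
def checkAllRuns : Bool :=
  force (concat (3 * h.q) h.triples) fun N =>
    force (concat (3 * h.q) (h.triples.map fun _ => 2 ^ h.q - 1)) fun mask => h.checkRuns N mask

/-- The value 1 means an occurrence at position 0 and at no other position of the first image. Since
the first letter of the pair is arbitrary, every image begins with the marker. -/
def checkMarker (N : ℕ) : Bool :=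
  matchMask (2 ^ h.q - 1) N (h.code 0) h.marker == 1

def palMask (N n : ℕ) : List (ℕ × ℕ) → ℕ
  | [] => nonPalMask N n
  | w :: l => if w.1 = n then matchMask (2 ^ h.q - 1) N w.2 n ||| palMask N n l
      else palMask N n l

/-- Lengths run up to `maxPal + 2` so as to cover two consecutive lengths, one of each parity, at
which no palindrome is listed. Reduction modulo `2 ^ q` keeps the starting positions in the first
image. -/
def checkPals (N : ℕ) : Bool :=
  (List.range (h.maxPal + 3)).all fun n => h.palMask N n h.pals % 2 ^ h.q == 2 ^ h.q - 1

def checkDistinct (a b : Fin 4) : Bool :=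
  h.code a >>> h.suf != h.code b >>> h.suf && h.code a % 2 ^ h.pre != h.code b % 2 ^ h.pre

/-- Put β = `num / den`. The fourth condition says q + marker - 2 ≤ (β - 1) · period, so that long
periods force a marker into the overlap. The fifth says pre ≤ suf + 1 + (β - 2)q, so that the
overlap recovers enough letters wherever it starts. The bounds on `marker` and `maxPal` keep the
tested windows inside two images. -/
def checkSizes : Bool :=
  decide (0 < h.q ∧ 0 < h.den ∧ 2 * h.den ≤ h.num ∧
    h.den * (h.q + h.marker) + h.den * h.period ≤ h.num * h.period + 2 * h.den ∧
    h.den * h.pre + 2 * h.den * h.q ≤ h.den * (h.suf + 1) + h.num * h.q ∧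
    h.pre ≤ h.q ∧ h.maxPal + 2 ≤ h.q ∧ h.marker ≤ h.q ∧ ∀ w ∈ h.pals, w.1 ≤ h.maxPal)

def check : Bool :=
  h.checkSizes && h.checkAllRuns && letters.all fun a => decide (h.code a < 2 ^ h.q) &&
    letters.all fun b => a == b || (h.checkDistinct a b &&
      force (h.pair a b) (fun N => h.checkMarker N && h.checkPals N))

/-- The conditions that are verified by `check`. -/
structure Valid : Prop where
  q_pos : 0 < h.q
  den_pos : 0 < h.den
  two_den_le : 2 * h.den ≤ h.num
  period_le : h.den * (h.q + h.marker) + h.den * h.period ≤ h.num * h.period + 2 * h.den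
  cut : h.den * h.pre + 2 * h.den * h.q ≤ h.den * (h.suf + 1) + h.num * h.q
  pre_le : h.pre ≤ h.q
  maxPal_le : h.maxPal + 2 ≤ h.q
  marker_le : h.marker ≤ h.q
  length_le : ∀ w ∈ h.pals, w.1 ≤ h.maxPal
  code_lt : ∀ a, h.code a < 2 ^ h.q
  distinct : ∀ a b, a ≠ b → h.checkDistinct a b = true
  markers : ∀ a b, a ≠ b → h.checkMarker (h.pair a b) = true
  palindromes : ∀ a b, a ≠ b → h.checkPals (h.pair a b) = true
  runs : h.checkRuns (concat (3 * h.q) h.triples)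
    (concat (3 * h.q) (h.triples.map fun _ => 2 ^ h.q - 1)) = true

variable {h}

theorem valid_of_check (hc : h.check = true) : h.Valid := by
  simp only [check, checkSizes, checkAllRuns, force_eq, Bool.and_eq_true, decide_eq_true_eq, List.all_eq_true,
    Bool.or_eq_true, beq_iff_eq] at hc
  obtain ⟨⟨⟨h1, h2, h3, h4, h5, h6, h7, h8, h9⟩, hruns⟩, hc⟩ := hc
  have key : ∀ a b, a ≠ b → _ := fun a b hab =>
    (((hc a (mem_letters a)).2 b (mem_letters b)).resolve_left hab)
  exact ⟨h1, h2, h3, h4, h5, h6, h7, h8, h9, fun a => (hc a (mem_letters a)).1,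
    fun a b hab => (key a b hab).1, fun a b hab => (key a b hab).2.1,
    fun a b hab => (key a b hab).2.2, hruns⟩

/-! ### Repetitions in images of squarefree words -/

variable (h) in
/-- The letter at position `i` of the image of `x`, as a truth value. -/
def bit (x : ℕ → Fin 4) (i : ℕ) : Bool := (h.code (x (i / h.q))).testBit (i % h.q)

variable (h) in
/-- The image of the infinite word `x`. -/
def image (x : ℕ → Fin 4) (i : ℕ) : Fin 2 := if h.bit x i then 1 else 0

theorem image_eq_iff (x y : ℕ → Fin 4) (i j : ℕ) :
    h.image x i = h.image y j ↔ h.bit x i = h.bit y j := by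
  unfold image
  cases h.bit x i <;> cases h.bit y j <;> simp

theorem bit_mul_add (x : ℕ → Fin 4) (k i : ℕ) (hi : i < h.q) :
    h.bit x (k * h.q + i) = (h.code (x k)).testBit i := by
  have hq : 0 < h.q := by omega
  rw [bit, Nat.add_comm, Nat.add_mul_div_right _ _ hq, Nat.div_eq_of_lt hi, Nat.zero_add,
    Nat.add_mul_mod_self_right, Nat.mod_eq_of_lt hi]

theorem testBit_pair (hv : h.Valid) (x : ℕ → Fin 4) (k i : ℕ) (hi : i < 2 * h.q) :
    (h.pair (x k) (x (k + 1))).testBit i = h.bit x (k * h.q + i) := by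
  rw [pair, Nat.testBit_two_pow_mul_add _ (hv.code_lt _)]
  split_ifs with hiq
  · rw [bit_mul_add x k i hiq]
  · rw [← bit_mul_add x (k + 1) _ (by omega), Nat.add_mul]
    congr 1
    omega

theorem testBit_triple (hv : h.Valid) (x : ℕ → Fin 4) (k i : ℕ) (hi : i < 3 * h.q) :
    (h.triple (x k) (x (k + 1)) (x (k + 2))).testBit i = h.bit x (k * h.q + i) := by
  rw [triple, Nat.testBit_two_pow_mul_add _ (hv.code_lt _)]
  split_ifs with hiq
  · rw [bit_mul_add x k i hiq]
  · rw [testBit_pair hv x (k + 1) _ (by omega), Nat.add_mul]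
    congr 1
    omega

theorem triple_lt (hv : h.Valid) (a b c : Fin 4) : h.triple a b c < 2 ^ (3 * h.q) := by
  have ha := hv.code_lt a
  have hb := hv.code_lt b
  have hc := hv.code_lt c
  rw [triple, pair, show 3 * h.q = h.q + (h.q + h.q) by omega, pow_add, pow_add]
  generalize 2 ^ h.q = Q at *
  calc Q * (Q * h.code c + h.code b) + h.code a
      < Q * (Q * h.code c + h.code b) + Q := by omega
    _ = Q * (Q * h.code c + h.code b + 1) := by ring
    _ ≤ Q * (Q * h.code c + Q) := Nat.mul_le_mul_left _ (by omega)
    _ = Q * (Q * (h.code c + 1)) := by ring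
    _ ≤ Q * (Q * Q) := Nat.mul_le_mul_left _ (Nat.mul_le_mul_left _ hc)

theorem lt_of_mem_triples (hv : h.Valid) (n : ℕ) (hn : n ∈ h.triples) : n < 2 ^ (3 * h.q) := by
  simp only [triples, List.mem_flatMap, List.mem_map] at hn
  obtain ⟨a, -, b, -, c, -, rfl⟩ := hn
  exact triple_lt hv a b c

theorem triple_mem_triples {a b c : Fin 4} (hab : a ≠ b) (hbc : b ≠ c) :
    h.triple a b c ∈ h.triples := by
  simp only [triples, List.mem_flatMap, List.mem_map, List.mem_filter]
  exact ⟨a, mem_letters a, b, ⟨mem_letters b, by simpa using hab⟩, c,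
    ⟨mem_letters c, by simpa using hbc⟩, rfl⟩

theorem _root_.InfWord.SquarefreeInf.ne_succ {A : Type*} {x : ℕ → A} (hx : SquarefreeInf x)
    (k : ℕ) : x k ≠ x (k + 1) := by
  intro heq
  refine hx k 1 one_pos fun j hj => ?_
  obtain rfl : j = 0 := by omega
  exact heq

theorem testBit_of_mod_eq {N q i : ℕ} (hN : N % 2 ^ q = 2 ^ q - 1) (hi : i < q) :
    N.testBit i = true := by
  have := congrArg (fun n => n.testBit i) hN
  simpa [hi] using this

/-- A run may be assumed to start in the first image of a triple, whose adjacent letters differ by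
squarefreeness. The checked bound `overlap p + p ≤ 2 * q + 1` makes the shortest forbidden
repetition end inside the third image. -/
theorem not_run_of_lt_period (hv : h.Valid) {x : ℕ → Fin 4} (hx : SquarefreeInf x) {s p l : ℕ}
    (hp : 0 < p) (hpp : p < h.period) (hl : h.num * p < h.den * (l + p)) :
    ¬ ∀ j < l, h.bit x (s + j) = h.bit x (s + j + p) := by
  intro hrun
  have hc := hv.runs
  obtain ⟨t, ht⟩ := exists_testBit_concat (3 * h.q) (2 ^ h.q - 1)
    (lt_of_lt_of_le (Nat.sub_lt (by positivity) one_pos)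
      (Nat.pow_le_pow_right two_pos (by omega))) h.triples (lt_of_mem_triples hv) _
    (triple_mem_triples (hx.ne_succ (s / h.q)) (hx.ne_succ (s / h.q + 1)))
  simp only [checkRuns, List.all_eq_true, List.mem_range, Bool.or_eq_true, beq_iff_eq,
    Bool.and_eq_true, decide_eq_true_eq] at hc
  obtain ⟨hlen, hc⟩ := (hc p hpp).resolve_left (by omega)
  have hmod : s % h.q < h.q := Nat.mod_lt _ hv.q_pos
  -- Exponent at least 2 makes the overlap positive, so the truncated subtraction in `overlap` is
  -- exact.
  have hle : p + p ≤ h.num * p / h.den := by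
    rw [Nat.le_div_iff_mul_le hv.den_pos]
    calc (p + p) * h.den = 2 * h.den * p := by ring
      _ ≤ _ := Nat.mul_le_mul_right _ hv.two_den_le
  have hlt : h.num * p / h.den < l + p := by
    rw [Nat.div_lt_iff_lt_mul hv.den_pos]
    rwa [Nat.mul_comm (l + p)]
  have hov : h.overlap p = h.num * p / h.den + 1 - p := rfl
  have hmask := congrArg (fun n => n.testBit (t + s % h.q)) hc
  simp only [Nat.testBit_and, (ht (s % h.q) (by omega)).2, Nat.testBit_two_pow_sub_one, hmod,
    decide_true, Bool.and_true] at hmask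
  obtain ⟨j, hj, hbit⟩ := exists_of_testBit_spread _ _ _ _ _ one_pos (by omega) hmask
  simp only [Nat.testBit_xor, Nat.testBit_shiftRight] at hbit
  rw [show t + s % h.q + j = t + (s % h.q + j) by omega, Nat.add_left_comm p t,
    (ht _ (by omega)).1, (ht _ (by omega)).1, testBit_triple hv x _ _ (by omega), testBit_triple hv x _ _ (by omega)] at hbit
  have hs : s / h.q * h.q + s % h.q = s := Nat.div_add_mod' s h.q
  rw [show s / h.q * h.q + (s % h.q + j) = s + j by omega,
    show s / h.q * h.q + (p + (s % h.q + j)) = s + j + p by omega, hrun j (by omega)] at hbit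
  simp at hbit

theorem marker_iff (hv : h.Valid) {x : ℕ → Fin 4} (hx : SquarefreeInf x) (s : ℕ) :
    (∀ j < h.marker, h.bit x (s + j) = (h.code 0).testBit j) ↔ h.q ∣ s := by
  have hmod : s % h.q < h.q := Nat.mod_lt _ hv.q_pos
  have hs : s / h.q * h.q + s % h.q = s := Nat.div_add_mod' s h.q
  have hc := hv.markers _ _ (hx.ne_succ (s / h.q))
  rw [checkMarker, beq_iff_eq] at hc
  have hm := testBit_matchMask h.q (h.pair (x (s / h.q)) (x (s / h.q + 1))) (h.code 0) h.marker
    (s % h.q) hmod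
  rw [hc, Nat.testBit_one_eq_true_iff_self_eq_zero] at hm
  rw [Nat.dvd_iff_mod_eq_zero, hm]
  have := hv.marker_le
  refine forall₂_congr fun j hj => ?_
  rw [testBit_pair hv x _ _ (by omega)]
  rw [show s / h.q * h.q + (s % h.q + j) = s + j by omega]

theorem dvd_period (hv : h.Valid) {x : ℕ → Fin 4} (hx : SquarefreeInf x) {s p l : ℕ}
    (hpp : h.period ≤ p) (hl : h.num * p < h.den * (l + p))
    (hrun : ∀ j < l, h.bit x (s + j) = h.bit x (s + j + p)) : h.q ∣ p := by
  -- The overlap has length at least q + marker - 1, exactly what ensures a complete marker at a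
  -- multiple of q.
  have hlen : h.q + h.marker < l + 2 := by
    have h1 := hv.period_le
    have h2 := hv.two_den_le
    obtain ⟨d, rfl⟩ := Nat.exists_eq_add_of_le hpp
    have h3 : h.den * d ≤ h.num * d := Nat.mul_le_mul_right _ (by omega)
    have h4 : h.den * (h.q + h.marker) < h.den * (l + 2) := by linarith
    exact Nat.lt_of_mul_lt_mul_left h4
  obtain ⟨t, hts, htq, ht⟩ : ∃ t, s ≤ t ∧ t < s + h.q ∧ h.q ∣ t := by
    have h1 := Nat.div_add_mod (s + h.q - 1) h.q
    have h2 := Nat.mod_lt (s + h.q - 1) hv.q_pos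
    refine ⟨h.q * ((s + h.q - 1) / h.q), by omega, by omega, dvd_mul_right _ _⟩
  have hp := (marker_iff hv hx (t + p)).1 fun j hj => by
    rw [← (marker_iff hv hx t).2 ht j hj]
    have := hrun (t - s + j) (by omega)
    rw [show s + (t - s + j) = t + j by omega] at this
    rw [this, Nat.add_right_comm]
  exact (Nat.dvd_add_right ht).1 hp

theorem eq_of_suffix (hv : h.Valid) {a b : Fin 4}
    (heq : ∀ j, h.suf ≤ j → j < h.q → (h.code a).testBit j = (h.code b).testBit j) : a = b := by
  by_contra hab
  have hd := hv.distinct a b hab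
  simp only [checkDistinct, Bool.and_eq_true, bne_iff_ne, ne_eq] at hd
  refine hd.1 (Nat.eq_of_testBit_eq fun j => ?_)
  rw [Nat.testBit_shiftRight, Nat.testBit_shiftRight]
  rcases lt_or_ge (h.suf + j) h.q with hj | hj
  · exact heq _ (by omega) hj
  · have hle := Nat.pow_le_pow_right two_pos hj
    rw [Nat.testBit_lt_two_pow ((hv.code_lt a).trans_le hle),
      Nat.testBit_lt_two_pow ((hv.code_lt b).trans_le hle)]

theorem eq_of_prefix (hv : h.Valid) {a b : Fin 4}
    (heq : ∀ j < h.pre, (h.code a).testBit j = (h.code b).testBit j) : a = b := by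
  by_contra hab
  have hd := hv.distinct a b hab
  simp only [checkDistinct, Bool.and_eq_true, bne_iff_ne, ne_eq] at hd
  refine hd.2 (Nat.eq_of_testBit_eq fun j => ?_)
  rw [Nat.testBit_mod_two_pow, Nat.testBit_mod_two_pow]
  by_cases hj : j < h.pre
  · simp [hj, heq j hj]
  · simp [hj]

/-- The run compares each image with the one `r` places later. If it starts at offset at most `suf`
in an image, that image's suffix and the next `r - 1` images identify `r` letters; otherwise `r`
letters are identified by prefixes, starting with the next image. Both ways the source word has a
square. -/
theorem not_run_of_dvd_period (hv : h.Valid) {x : ℕ → Fin 4} (hx : SquarefreeInf x) {s r l : ℕ}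
    (hr : 0 < r) (hl : h.num * (r * h.q) < h.den * (l + r * h.q)) :
    ¬ ∀ j < l, h.bit x (s + j) = h.bit x (s + j + r * h.q) := by
  intro hrun
  have hden := hv.den_pos
  have hpre := hv.pre_le
  have hlen : r * h.q < l ∧ r * h.q + h.pre < l + (h.suf + 1) := by
    -- With d = num - 2·den, the excess of the overlap over the period is more than d·r·q / den,
    -- which is smallest at r = 1; there `cut` applies.
    obtain ⟨d, hd⟩ := Nat.exists_eq_add_of_le hv.two_den_le
    obtain ⟨r, rfl⟩ := Nat.exists_eq_add_of_le hr
    have hcut := hv.cut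
    rw [hd] at hl hcut
    have hnn : 0 ≤ d * (r * h.q) := Nat.zero_le _
    have hnn' : 0 ≤ d * h.q := Nat.zero_le _
    constructor
    · refine Nat.lt_of_mul_lt_mul_left (a := h.den) ?_
      linarith
    · refine Nat.lt_of_mul_lt_mul_left (a := h.den) ?_
      linarith
  have hmod : s % h.q < h.q := Nat.mod_lt _ hv.q_pos
  have hs : s / h.q * h.q + s % h.q = s := Nat.div_add_mod' s h.q
  set k := s / h.q
  set o := s % h.q
  have hblock : ∀ t j, j < h.q → s ≤ t * h.q + j → t * h.q + j < s + l →
      (h.code (x t)).testBit j = (h.code (x (t + r))).testBit j := by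
    intro t j hj h1 h2
    have := hrun (t * h.q + j - s) (by omega)
    rw [show s + (t * h.q + j - s) = t * h.q + j by omega,
      show t * h.q + j + r * h.q = (t + r) * h.q + j by ring, bit_mul_add x t j hj,
      bit_mul_add x (t + r) j hj] at this
    exact this
  rcases le_or_gt o h.suf with ho | ho
  · refine hx k r hr fun u hu => ?_
    rw [Nat.add_right_comm]
    refine eq_of_suffix hv fun j h1 h2 => ?_
    have hur : (u + 1) * h.q ≤ r * h.q := Nat.mul_le_mul_right _ hu
    refine hblock _ j h2 ?_ ?_ <;> rw [Nat.add_mul] <;> rw [Nat.add_mul] at hur <;> omega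
  · refine hx (k + 1) r hr fun u hu => ?_
    rw [Nat.add_right_comm (k + 1) r u]
    refine eq_of_prefix hv fun j hj => ?_
    have hur : (u + 1) * h.q ≤ r * h.q := Nat.mul_le_mul_right _ hu
    refine hblock _ j (by omega) ?_ ?_ <;> rw [Nat.add_mul, Nat.add_mul] <;>
      rw [Nat.add_mul] at hur <;> omega

theorem not_run (hv : h.Valid) {x : ℕ → Fin 4} (hx : SquarefreeInf x) {s p l : ℕ} (hp : 0 < p)
    (hl : h.num * p < h.den * (l + p)) :
    ¬ ∀ j < l, h.bit x (s + j) = h.bit x (s + j + p) := by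
  intro hrun
  rcases lt_or_ge p h.period with hpp | hpp
  · exact not_run_of_lt_period hv hx hp hpp hl hrun
  · obtain ⟨r, rfl⟩ := dvd_period hv hx hpp hl hrun
    rw [Nat.mul_comm h.q r] at hl hrun hp
    exact not_run_of_dvd_period hv hx (Nat.pos_of_mul_pos_right hp) hl hrun

end Morphism

/-- A prefix of a power of `u` has period `|u|`. -/
theorem getElem_add_length_of_prefix_power {A : Type*} {v u : List A} {k : ℕ}
    (hv : v <+: (List.replicate k u).flatten) (j : ℕ) (hj : j + u.length < v.length) :
    v[j] = v[j + u.length] := by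
  cases k with
  | zero =>
    obtain rfl : v = [] := by simpa using hv
    simp at hj
  | succ k =>
    have hcomm : (List.replicate (k + 1) u).flatten = (List.replicate k u).flatten ++ u := by
      rw [List.replicate_succ', List.flatten_append]
      simp
    have h₁ := hv.getElem (i := j) (by omega)
    have h₂ := hv.getElem hj
    have hlen := hv.length_le
    rw [hcomm, List.length_append] at hlen
    rw [h₁, h₂]
    have h₃ : (List.replicate (k + 1) u).flatten = u ++ (List.replicate k u).flatten := by
      simp [List.replicate_succ]
    simp only [hcomm]
    rw [List.getElem_append_left (by omega)]
    simp only [← hcomm, h₃]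
    rw [List.getElem_append_right (by omega)]
    simp

/-! ### Exponents, palindromes and prefix counts of the images -/

namespace Morphism

variable {h : Morphism}

theorem plusFree_image (hv : h.Valid) {x : ℕ → Fin 4} (hx : SquarefreeInf x) :
    PlusFree (h.num / h.den : ℚ) (h.image x) := by
  rintro ⟨v, u, e, ⟨i, hi⟩, ⟨hu, ⟨k, hk⟩, rfl⟩, hlt⟩
  have hup : 0 < u.length := List.length_pos_iff.2 hu
  have hden := hv.den_pos
  rw [div_lt_div_iff₀ (by exact_mod_cast hden) (by exact_mod_cast hup)] at hlt
  have hlt' : h.num * u.length < v.length * h.den := by exact_mod_cast hlt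
  have huv : u.length ≤ v.length := by
    by_contra! hc
    have h1 := Nat.mul_le_mul hv.two_den_le hc.le
    nlinarith
  refine not_run hv hx (s := i) (l := v.length - u.length) hup
    (by rw [Nat.sub_add_cancel huv, Nat.mul_comm h.den]; exact hlt') fun j hj => ?_
  have hval : ∀ j (hj : j < v.length), v[j] = h.image x (i + j) := by
    intro j hj
    rw [← getElem_block (h.image x) i v.length j (by rwa [length_block])]
    exact List.getElem_of_eq hi hj
  have := getElem_add_length_of_prefix_power hk j (by omega)
  rw [hval, hval, image_eq_iff] at this
  rw [this, Nat.add_assoc]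

theorem exists_of_testBit_palMask {N n i : ℕ} (hi : i < h.q) (l : List (ℕ × ℕ))
    (hbit : (h.palMask N n l).testBit i = true) :
    (nonPalMask N n).testBit i = true ∨
      ∃ w ∈ l, w.1 = n ∧ ∀ j < n, N.testBit (i + j) = w.2.testBit j := by
  induction l with
  | nil => exact Or.inl hbit
  | cons w l ih =>
    rw [palMask] at hbit
    split_ifs at hbit with hw
    · rw [Nat.testBit_or, Bool.or_eq_true, testBit_matchMask _ _ _ _ _ hi] at hbit
      rcases hbit with hbit | hbit
      · exact Or.inr ⟨w, List.mem_cons_self, hw, hbit⟩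
      · refine (ih hbit).imp_right ?_
        rintro ⟨w', hw', hrest⟩
        exact ⟨w', List.mem_cons_of_mem _ hw', hrest⟩
    · refine (ih hbit).imp_right ?_
      rintro ⟨w', hw', hrest⟩
      exact ⟨w', List.mem_cons_of_mem _ hw', hrest⟩

/-- The binary word with the given length and code. -/
def decode (w : ℕ × ℕ) : List (Fin 2) :=
  (List.range w.1).map fun j => if w.2.testBit j then 1 else 0

theorem reverse_block_iff {A : Type*} (x : ℕ → A) (i n : ℕ) :
    (block x i n).reverse = block x i n ↔
      ∀ j k : ℕ, j + k + 1 = n → x (i + j) = x (i + k) := by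
  rw [List.ext_getElem_iff]
  simp only [List.length_reverse, List.getElem_reverse, getElem_block, length_block, true_and]
  constructor
  · intro hrev j k hjk
    rw [← hrev k (by omega) (by omega)]
    congr 2
    omega
  · intro hrev k hk _
    exact hrev _ _ (by omega)

theorem mem_of_palindrome_of_le (hv : h.Valid) {x : ℕ → Fin 4} (hx : SquarefreeInf x) {i n : ℕ}
    (hn : n ≤ h.maxPal + 2) (hpal : (block (h.image x) i n).reverse = block (h.image x) i n) :
    ∃ w ∈ h.pals, w.1 = n ∧ block (h.image x) i n = decode w := by
  have hmod : i % h.q < h.q := Nat.mod_lt _ hv.q_pos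
  have hi : i / h.q * h.q + i % h.q = i := Nat.div_add_mod' i h.q
  have hc := hv.palindromes _ _ (hx.ne_succ (i / h.q))
  have hmax := hv.maxPal_le
  have hbit : ∀ j < n, (h.pair (x (i / h.q)) (x (i / h.q + 1))).testBit (i % h.q + j) =
      h.bit x (i + j) := by
    intro j hj
    rw [testBit_pair hv x _ _ (by omega)]
    congr 1
    omega
  simp only [checkPals, List.all_eq_true, List.mem_range, beq_iff_eq] at hc
  rcases exists_of_testBit_palMask hmod _ (testBit_of_mod_eq (hc n (by omega)) hmod) with
    hnon | ⟨w, hw, rfl, heq⟩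
  · obtain ⟨j, k, hjk, hne⟩ := not_palindrome_of_testBit_nonPalMask _ _ _ hnon
    rw [hbit j (by omega), hbit k (by omega)] at hne
    exact absurd ((image_eq_iff _ _ _ _).1 ((reverse_block_iff _ _ _).1 hpal j k hjk)) hne
  · refine ⟨w, hw, rfl, ?_⟩
    refine List.map_congr_left fun j hj => ?_
    rw [List.mem_range] at hj
    rw [← heq j hj, hbit j hj]
    rfl

/-- Removing both end letters of a palindrome leaves a palindrome, so every longer one would shrink
to length `maxPal + 1` or `maxPal + 2`, where none is listed. -/
theorem length_le_of_palindrome (hv : h.Valid) {x : ℕ → Fin 4} (hx : SquarefreeInf x) (d : ℕ) :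
    ∀ i, (block (h.image x) i (h.maxPal + 1 + d)).reverse ≠
      block (h.image x) i (h.maxPal + 1 + d) := by
  induction d using Nat.strong_induction_on with
  | _ d ih =>
    intro i hpal
    rcases Nat.lt_or_ge d 2 with hd | hd
    · obtain ⟨w, hw, hwn, -⟩ := mem_of_palindrome_of_le hv hx (by omega) hpal
      have := hv.length_le w hw
      omega
    · refine ih (d - 2) (by omega) (i + 1) ?_
      rw [reverse_block_iff] at hpal ⊢
      intro j k hjk
      have := hpal (j + 1) (k + 1) (by omega)
      rwa [show i + 1 + j = i + (j + 1) by omega, show i + 1 + k = i + (k + 1) by omega]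

theorem encard_palindromes_image_le (hv : h.Valid) {x : ℕ → Fin 4} (hx : SquarefreeInf x) :
    (InfWord.palindromes (h.image x)).encard ≤ h.pals.length := by
  classical
  have hsub : InfWord.palindromes (h.image x) ⊆ ((h.pals.map decode).toFinset : Set _) := by
    rintro w ⟨⟨i, hi⟩, hpal⟩
    have hle : w.length ≤ h.maxPal := by
      by_contra! hc
      refine length_le_of_palindrome hv hx (w.length - (h.maxPal + 1)) i ?_
      rw [show h.maxPal + 1 + (w.length - (h.maxPal + 1)) = w.length by omega, ← hi, hpal]
    obtain ⟨c, hc, -, hdec⟩ := mem_of_palindrome_of_le hv hx (i := i) (n := w.length) (by omega)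
      (by rw [← hi, hpal])
    rw [List.coe_toFinset]
    exact List.mem_map.2 ⟨c, hc, by rw [← hdec, ← hi]⟩
  calc _ ≤ ((h.pals.map decode).toFinset : Set (List (Fin 2))).encard := Set.encard_le_encard hsub
    _ = ((h.pals.map decode).toFinset.card : ℕ∞) := Set.encard_coe_eq_coe_finsetCard _
    _ ≤ _ := by
      have := List.toFinset_card_le (h.pals.map decode)
      rw [List.length_map] at this
      exact_mod_cast this

theorem image_mem_fewPalindromes (hv : h.Valid) {x : ℕ → Fin 4} (hx : SquarefreeInf x) :
    h.image x ∈ fewPalindromes h.pals.length (h.num / h.den) :=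
  ⟨plusFree_image hv hx, encard_palindromes_image_le hv hx⟩

theorem block_eq_of_block_image_eq (hv : h.Valid) {x y : ℕ → Fin 4} {n N : ℕ}
    (hN : n * h.q ≤ N) (heq : block (h.image x) 0 N = block (h.image y) 0 N) :
    block x 0 n = block y 0 n := by
  rw [block_eq_block_iff] at heq ⊢
  intro k hk
  rw [Nat.zero_add]
  refine eq_of_prefix hv fun j hj => ?_
  have hjq : j < h.q := hj.trans_le hv.pre_le
  have hkn : (k + 1) * h.q ≤ n * h.q := Nat.mul_le_mul_right _ hk
  rw [← bit_mul_add x k j hjq, ← bit_mul_add y k j hjq, ← image_eq_iff]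
  have := heq (k * h.q + j) (by rw [Nat.add_mul] at hkn; omega)
  rwa [Nat.zero_add] at this

theorem finite_prefixes (S : Set (ℕ → Fin 2)) (n : ℕ) : (prefixes S n).Finite := by
  refine (List.finite_length_eq (Fin 2) n).subset ?_
  rintro w ⟨x, -, rfl⟩
  exact length_block x 0 n

theorem two_pow_le_ncard_prefixes (hv : h.Valid) (N : ℕ) :
    2 ^ (N / h.q) ≤ (prefixes (fewPalindromes h.pals.length (h.num / h.den)) N).ncard := by
  classical
  refine (two_pow_le_ncard_prefixes_squarefree (N / h.q)).trans ?_
  have hex : ∀ w : List (Fin 4), ∃ x : ℕ → Fin 4,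
      (∃ x, SquarefreeInf x ∧ block x 0 (N / h.q) = w) →
        SquarefreeInf x ∧ block x 0 (N / h.q) = w := by
    intro w
    by_cases hw : ∃ x, SquarefreeInf x ∧ block x 0 (N / h.q) = w
    · exact ⟨hw.choose, fun _ => hw.choose_spec⟩
    -- A dummy value, as `f` is only used on prefixes of squarefree words.
    · exact ⟨fun _ => 0, fun hw' => absurd hw' hw⟩
  choose f hf using hex
  refine Set.ncard_le_ncard_of_injOn (fun w => block (h.image (f w)) 0 N) ?_ ?_
    (finite_prefixes _ _)
  · intro w hw
    exact ⟨_, image_mem_fewPalindromes hv (hf w hw).1, rfl⟩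
  · intro w hw w' hw' heq
    rw [← (hf w hw).2, ← (hf w' hw').2]
    exact block_eq_of_block_image_eq hv (Nat.div_mul_le_self _ _) heq

theorem exponentiallyMany (hc : h.check = true) :
    ExponentiallyMany (fewPalindromes h.pals.length (h.num / h.den)) := by
  have hv := valid_of_check hc
  have hq : (0 : ℝ) < h.q := by exact_mod_cast hv.q_pos
  -- The growth rate is 2^(1/q); the factor 1/2 pays for rounding n/q down.
  refine ⟨1 / 2, (2 : ℝ) ^ (1 / h.q : ℝ), by norm_num,
    Real.one_lt_rpow (by norm_num) (by positivity), fun n => ?_⟩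
  have hle : (n : ℝ) ≤ h.q * ((n / h.q : ℕ) + 1) := by
    exact_mod_cast (Nat.lt_mul_div_succ n hv.q_pos).le
  calc (1 / 2 : ℝ) * ((2 : ℝ) ^ (1 / h.q : ℝ)) ^ n
      = 1 / 2 * (2 : ℝ) ^ ((n : ℝ) / h.q) := by
        rw [← Real.rpow_natCast, ← Real.rpow_mul (by norm_num)]
        congr 2
        ring
    _ ≤ 1 / 2 * (2 : ℝ) ^ (((n / h.q : ℕ) : ℝ) + 1) := by
        gcongr
        · norm_num
        · rwa [div_le_iff₀' hq]
    _ = (2 : ℝ) ^ (n / h.q) := by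
        rw [Real.rpow_add_one (by norm_num), Real.rpow_natCast]
        ring
    _ ≤ _ := by exact_mod_cast two_pow_le_ncard_prefixes hv n

end Morphism

end InfWord

/-! ### The eight morphisms and their verification -/

namespace InfWord

/-- A morphism whose images of squarefree words have at most 11 palindromes. -/
def morphismEleven : Morphism where
  q := 110
  num := 10
  den := 3
  marker := 32
  period := 60
  pre := 71
  suf := 61
  maxPal := 5
  code := ![
    0x268d3469a68d3468d34d1a34d1a6,
    0x268d1a69a3469a68d34d1a34d1a6,
    0x268d3468d34d1a69a34d1a34d1a6,
    0x268d3469a68d1a69a34d1a34d1a6]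
  pals := [
    (0, 0), (1, 0), (1, 1), (2, 0), (2, 3), (3, 0), (3, 2), (3, 5), (4, 6), (4, 9), (5, 17)]

theorem check_morphismEleven : morphismEleven.check = true := by
  decide +kernel

/-- A morphism whose images of squarefree words have at most 12 palindromes. -/
def morphismTwelve : Morphism where
  q := 157
  num := 23
  den := 7
  marker := 55
  period := 92
  pre := 130
  suf := 111
  maxPal := 5
  code := ![
    0x1d1d1d3a747474e9d1d3a3a74e8e8e9d1d3a7474,
    0x1d1d1d3a7474e8e8e9d3a3a74e8e8e9d1d3a7474,
    0x1d1d3a747474e8e8e9d3a3a74e8e8e9d1d3a7474,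
    0x1d3a3a3a74e8e9d3a3a3a7474e8e8e9d1d3a7474]
  pals := [
    (0, 0), (1, 0), (1, 1), (2, 0), (2, 3), (3, 0), (3, 2), (3, 5), (3, 7), (4, 9), (5, 14),
    (5, 17)]

theorem check_morphismTwelve : morphismTwelve.check = true := by
  decide +kernel

/-- A morphism whose images of squarefree words have at most 13 palindromes. -/
def morphismThirteen : Morphism where
  q := 65
  num := 3
  den := 1
  marker := 11
  period := 37
  pre := 62
  suf := 59
  maxPal := 6
  code := ![
    0x12c58989a34646591,
    0x14c58989a34646591,
    0x146468c8c8d346591,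
    0x12346468d34646591]
  pals := [
    (0, 0), (1, 0), (1, 1), (2, 0), (2, 3), (3, 0), (3, 2), (3, 5), (4, 6), (4, 9), (5, 4),
    (5, 17), (6, 12)]

theorem check_morphismThirteen : morphismThirteen.check = true := by
  decide +kernel

/-- A morphism whose images of squarefree words have at most 15 palindromes. -/
def morphismFifteen : Morphism where
  q := 105
  num := 8
  den := 3
  marker := 16
  period := 72
  pre := 52
  suf := 78
  maxPal := 7
  code := ![
    0x164b2d964b2d964b6592cb64b25,
    0x165b2596c96cb2596c96cb64b25,
    0x164b2d92d96c965b2c96cb64b25,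
    0x16592cb64b6592cb6592cb64b25]
  pals := [
    (0, 0), (1, 0), (1, 1), (2, 0), (2, 3), (3, 2), (3, 5), (4, 6), (4, 9), (5, 4), (5, 27),
    (6, 18), (6, 45), (7, 54), (7, 73)]

theorem check_morphismFifteen : morphismFifteen.check = true := by
  decide +kernel

/-- A morphism whose images of squarefree words have at most 18 palindromes. -/
def morphismEighteen : Morphism where
  q := 144
  num := 13
  den := 5
  marker := 29
  period := 107
  pre := 118
  suf := 110
  maxPal := 9
  code := ![
    0x2d65996b32d65accb32d65accb59665accb3,
    0x2d665acb32d65accb32d65accb59665accb3,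
    0x2d65accb59665acb599665accb59665accb3,
    0x2d665acb5996b2ccb596b32ccb59665accb3]
  pals := [
    (0, 0), (1, 0), (1, 1), (2, 0), (2, 3), (3, 2), (3, 5), (4, 6), (4, 9), (5, 21), (6, 12),
    (6, 45), (6, 51), (7, 107), (8, 90), (8, 102), (8, 153), (9, 214)]

theorem check_morphismEighteen : morphismEighteen.check = true := by
  decide +kernel

/-- A morphism whose images of squarefree words have at most 19 palindromes. -/
def morphismNineteen : Morphism where
  q := 244
  num := 28
  den := 11
  marker := 30
  period := 176
  pre := 193
  suf := 67
  maxPal := 9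
  code := ![
    0x9ad29ad34a6b4a694d69ad29ad34a6b4a694d694d69ad29ad34a6b4d694d2,
    0x9ad29ad34a6b4a694d69ad29ad34a6b4a694d694d69a535a534a6b4d694d2,
    0x9ad29ad34a6b4a694d69a535a534a6b4a6b4d694d69a535a534a6b4d694d2,
    0x9ad29ad35a535a694d69ad29ad34a6b4a694d694d69ad29ad34a6b4d694d2]
  pals := [
    (0, 0), (1, 0), (1, 1), (2, 0), (2, 3), (3, 2), (3, 5), (4, 6), (4, 9), (5, 10), (5, 21),
    (6, 18), (6, 45), (7, 20), (7, 107), (8, 90), (8, 165), (9, 214), (9, 297)]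

theorem check_morphismNineteen : morphismNineteen.check = true := by
  decide +kernel

/-- A morphism whose images of squarefree words have at most 21 palindromes. -/
def morphismTwentyOne : Morphism where
  q := 166
  num := 5
  den := 2
  marker := 9
  period := 116
  pre := 121
  suf := 127
  maxPal := 11
  code := ![
    0x9b3269b32699b26699b2c99b2669b32699b266cb3,
    0x9b3269b32c99b2669b32c99b2669b32699b266cb3,
    0x9a6cc9b32c99a66c99b2c99b2669b32699b266cb3,
    0x9b32699a6cc9a66c99b2c99b2669b32699b266cb3]
  pals := [
    (0, 0), (1, 0), (1, 1), (2, 0), (2, 3), (3, 2), (3, 5), (4, 6), (4, 9), (5, 4), (5, 27),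
    (6, 12), (6, 51), (7, 54), (7, 73), (8, 102), (8, 153), (9, 108), (9, 403), (11, 806),
    (11, 1241)]

theorem check_morphismTwentyOne : morphismTwentyOne.check = true := by
  decide +kernel

/-- A morphism whose images of squarefree words have at most 25 palindromes. -/
def morphismTwentyFive : Morphism where
  q := 183
  num := 7
  den := 3
  marker := 21
  period := 152
  pre := 142
  suf := 146
  maxPal := 13
  code := ![
    0x26cb365932c9b2cd932c9b34c9b2cd934c9b34d934d9a6,
    0x26cb365936699365932cd934c9b2cd934c9b34d934d9a6,
    0x26cb26cd364cb365932c9b34c9b2cd934c9b34d934d9a6,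
    0x26cb364cb26cb365932c9b34c9b2cd934c9b34d934d9a6]
  pals := [
    (0, 0), (1, 0), (1, 1), (2, 0), (2, 3), (3, 2), (3, 5), (4, 6), (4, 9), (5, 4), (5, 27),
    (6, 12), (6, 51), (7, 54), (7, 73), (8, 102), (8, 153), (9, 108), (9, 403), (10, 306),
    (10, 717), (11, 806), (11, 1241), (13, 2482), (13, 5709)]

theorem check_morphismTwentyFive : morphismTwentyFive.check = true := by
  decide +kernel

end InfWord

theorem theorem3 :
    InfWord.ExponentiallyMany (InfWord.fewPalindromes 11 (10 / 3)) ∧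
    InfWord.ExponentiallyMany (InfWord.fewPalindromes 12 (23 / 7)) ∧
    InfWord.ExponentiallyMany (InfWord.fewPalindromes 13 3) ∧
    InfWord.ExponentiallyMany (InfWord.fewPalindromes 15 (8 / 3)) ∧
    InfWord.ExponentiallyMany (InfWord.fewPalindromes 18 (13 / 5)) ∧
    InfWord.ExponentiallyMany (InfWord.fewPalindromes 19 (28 / 11)) ∧
    InfWord.ExponentiallyMany (InfWord.fewPalindromes 21 (5 / 2)) ∧
    InfWord.ExponentiallyMany (InfWord.fewPalindromes 25 (7 / 3)) := by
  refine ⟨?_, ?_, ?_, ?_, ?_, ?_, ?_, ?_⟩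
  · simpa [InfWord.morphismEleven] using InfWord.Morphism.exponentiallyMany InfWord.check_morphismEleven
  · simpa [InfWord.morphismTwelve] using InfWord.Morphism.exponentiallyMany InfWord.check_morphismTwelve
  · simpa [InfWord.morphismThirteen] using InfWord.Morphism.exponentiallyMany InfWord.check_morphismThirteen
  · simpa [InfWord.morphismFifteen] using InfWord.Morphism.exponentiallyMany InfWord.check_morphismFifteen
  · simpa [InfWord.morphismEighteen] using InfWord.Morphism.exponentiallyMany InfWord.check_morphismEighteen
  · simpa [InfWord.morphismNineteen] using InfWord.Morphism.exponentiallyMany InfWord.check_morphismNineteen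
  · simpa [InfWord.morphismTwentyOne] using InfWord.Morphism.exponentiallyMany InfWord.check_morphismTwentyOne
  · simpa [InfWord.morphismTwentyFive] using InfWord.Morphism.exponentiallyMany InfWord.check_morphismTwentyFive
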